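/- Let $n,p$ be integers with $2\le p\le n-2$ and let $\beta>0$. Equip the Stiefel manifold $\mathrm{St}(n,p)=\{X\in\mathbb{R}^{n\times p}\mid X^\top X=I_p\}$ with the Riemannian metric $g$ defined as follows: for $X\in\mathrm{St}(n,p)$, $X_\perp$ such that $[X\ X_\perp]$ is orthogonal, and tangent vectors $\xi_i=XA_i+X_\perp H_i$ with $A_i\in\mathbb{R}^{p\times p}$ skew-symmetric and $H_i\in\mathbb{R}^{(n-p)\times p}$ $(i=1,2)$, \[ g_X(\xi_1,\xi_2)=\beta\,\mathrm{trace}(A_1^\top A_2)+\mathrm{trace}(H_1^\top H_2). \] Let $d$ be the induced Riemannian distance and let \[ \mathrm{inj}_{\mathrm{St}_\beta(n,p)}=\inf_{X,\;\xi}\ \sup\{t>0\mid d(X,\gamma_\xi(t))=t\} \] be the injectivity radius of this Riemannian manifold, where $X$ runs over $\mathrm{St}(n,p)$, $\xi$ over the $g$-unit tangent vectors at $X$, and $\gamma_\xi$ is the geodesic with $\gamma_\xi(0)=X$, $\gamma_\xi'(0)=\xi$. Then the equation $\frac{\sin t}{t}+\frac{1-\beta}{\beta}\cos t=0$ has a smallest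 positive solution $t^{\mathrm r}_\beta$, and \[ \mathrm{inj}_{\mathrm{St}_\beta(n,p)}\le\min\{\sqrt{2\beta}\,\pi,\ \pi,\ t^{\mathrm r}_\beta\sqrt2\}. \] -/

import Mathlib

/-! The Stiefel manifold with the one-parameter family of metrics of Hüper, Markina and
Silva Leite, and the injectivity radius of the resulting complete Riemannian manifold. -/

namespace StiefelInj

noncomputable section

open scoped ENNReal ContDiff

attribute [local instance] Matrix.frobeniusNormedAddCommGroup Matrix.frobeniusNormedSpace

/-- The Stiefel manifold `St(n,p)` of orthonormal `p`-frames in `ℝⁿ`, a closed embedded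
submanifold of `ℝ^{n×p}`. -/
def stiefel (n p : ℕ) : Set (Matrix (Fin n) (Fin p) ℝ) :=
  {X | X.transpose * X = 1}

/-- The tangent space of the Stiefel manifold at `X`. -/
def tangentSpace {n p : ℕ} (X : Matrix (Fin n) (Fin p) ℝ) :
    Set (Matrix (Fin n) (Fin p) ℝ) :=
  {ξ | X.transpose * ξ + ξ.transpose * X = 0}

/-- The metric `g_β`: writing `ξ = X A + X_⊥ H` and `η = X B + X_⊥ K` with `[X X_⊥]` orthogonal,
`g_β(ξ, η) = β tr(Aᵀ B) + tr(Hᵀ K)`. Here `A = Xᵀ ξ` and `X_⊥ X_⊥ᵀ = 1 - X Xᵀ`;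
see `metric_eq`. -/
def metric {n p : ℕ} (β : ℝ) (X ξ η : Matrix (Fin n) (Fin p) ℝ) : ℝ :=
  β * ((X.transpose * ξ).transpose * (X.transpose * η)).trace
    + (ξ.transpose * (1 - X * X.transpose) * η).trace

theorem metric_eq {n p q : ℕ} (β : ℝ) (X : Matrix (Fin n) (Fin p) ℝ)
    (Xp : Matrix (Fin n) (Fin q) ℝ) (hX : X.transpose * X = 1)
    (hXp : Xp.transpose * Xp = 1) (hperp : X.transpose * Xp = 0)
    (A B : Matrix (Fin p) (Fin p) ℝ) (H K : Matrix (Fin q) (Fin p) ℝ) :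
    metric β X (X * A + Xp * H) (X * B + Xp * K)
      = β * (A.transpose * B).trace + (H.transpose * K).trace := by
  have e (C : Matrix (Fin p) (Fin p) ℝ) (L : Matrix (Fin q) (Fin p) ℝ) :
      X.transpose * (X * C + Xp * L) = C := by
    rw [Matrix.mul_add, ← Matrix.mul_assoc, ← Matrix.mul_assoc, hX, hperp]; simp
  have f : (1 - X * X.transpose) * (X * B + Xp * K) = Xp * K := by
    rw [Matrix.sub_mul, Matrix.mul_assoc, e]; simp
  have hperp' : Xp.transpose * X = 0 := by
    have := congrArg Matrix.transpose hperp
    simpa [Matrix.transpose_mul] using this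
  have k : (X * A + Xp * H).transpose * (Xp * K) = H.transpose * K := by
    rw [Matrix.transpose_add, Matrix.transpose_mul, Matrix.transpose_mul, Matrix.add_mul,
      Matrix.mul_assoc, Matrix.mul_assoc, ← Matrix.mul_assoc X.transpose, hperp,
      ← Matrix.mul_assoc Xp.transpose, hXp]
    simp
  rw [metric, e, e, Matrix.mul_assoc, f, k]

/-- The unit tangent space at `X`. -/
def unitTangent {n p : ℕ} (β : ℝ) (X : Matrix (Fin n) (Fin p) ℝ) :
    Set (Matrix (Fin n) (Fin p) ℝ) :=
  {ξ | ξ ∈ tangentSpace X ∧ metric β X ξ ξ = 1}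

/-- The length of a curve over `[a, b]`. -/
def curveLength {n p : ℕ} (β : ℝ) (γ : ℝ → Matrix (Fin n) (Fin p) ℝ) (a b : ℝ) : ℝ :=
  ∫ t in a..b, Real.sqrt (metric β (γ t) (deriv γ t) (deriv γ t))

/-- The energy of a curve over `[a, b]`. -/
def curveEnergy {n p : ℕ} (β : ℝ) (γ : ℝ → Matrix (Fin n) (Fin p) ℝ) (a b : ℝ) : ℝ :=
  (1 / 2) * ∫ t in a..b, metric β (γ t) (deriv γ t) (deriv γ t)

/-- `γ` restricted to `[a, b]` is a piecewise `C¹` curve in the Stiefel manifold: there is a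
finite partition `a = τ 0 ≤ ⋯ ≤ τ N = b` such that `γ` is `C¹` on each closed piece. -/
def IsPiecewiseC1 {n p : ℕ} (γ : ℝ → Matrix (Fin n) (Fin p) ℝ) (a b : ℝ) : Prop :=
  (∀ t ∈ Set.Icc a b, γ t ∈ stiefel n p) ∧
    ∃ (N : ℕ) (τ : ℕ → ℝ), Monotone τ ∧ τ 0 = a ∧ τ N = b ∧
      ∀ k < N, ContDiffOn ℝ 1 γ (Set.Icc (τ k) (τ (k + 1)))

/-- The Riemannian distance of `g_β`: the infimum of the lengths of the piecewise `C¹` curves in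
the Stiefel manifold from `X` to `Y`. -/
def stiefelDist {n p : ℕ} (β : ℝ) (X Y : Matrix (Fin n) (Fin p) ℝ) : ℝ≥0∞ :=
  sInf {L | ∃ (γ : ℝ → Matrix (Fin n) (Fin p) ℝ) (a b : ℝ), a ≤ b ∧ IsPiecewiseC1 γ a b ∧
    γ a = X ∧ γ b = Y ∧ L = ENNReal.ofReal (curveLength β γ a b)}

/-- `Γ s t` is a smooth variation of the curve `γ` in the Stiefel manifold, with variation
parameter `s`, that keeps the endpoints at `t = a` and `t = b` fixed. -/
structure IsProperVariation {n p : ℕ} (γ : ℝ → Matrix (Fin n) (Fin p) ℝ) (a b : ℝ)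
    (Γ : ℝ → ℝ → Matrix (Fin n) (Fin p) ℝ) : Prop where
  smooth : ContDiff ℝ ∞ (fun z : ℝ × ℝ => Γ z.1 z.2)
  mem : ∀ s t, Γ s t ∈ stiefel n p
  base : ∀ t, Γ 0 t = γ t
  left : ∀ s, Γ s a = γ a
  right : ∀ s, Γ s b = γ b

/-- `γ : ℝ → St(n,p)` is a geodesic of `g_β`: a smooth curve that, on every compact interval, is
a critical point of the energy under variations with fixed endpoints. (The manifold is compact,
hence complete, so that every geodesic extends to all of `ℝ`.) -/
structure IsGeodesic {n p : ℕ} (β : ℝ) (γ : ℝ → Matrix (Fin n) (Fin p) ℝ) : Prop where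
  smooth : ContDiff ℝ ∞ γ
  mem : ∀ t, γ t ∈ stiefel n p
  critical : ∀ a b : ℝ, a < b → ∀ Γ : ℝ → ℝ → Matrix (Fin n) (Fin p) ℝ,
    IsProperVariation γ a b Γ → HasDerivAt (fun s => curveEnergy β (Γ s) a b) 0 0

/-- The cut time `sup {t > 0 | d(γ(0), γ(t)) = t}` of a unit-speed geodesic `γ`. -/
def cutTime {n p : ℕ} (β : ℝ) (γ : ℝ → Matrix (Fin n) (Fin p) ℝ) : ℝ≥0∞ :=
  sSup {r | ∃ t : ℝ, 0 < t ∧ stiefelDist β (γ 0) (γ t) = ENNReal.ofReal t ∧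
    r = ENNReal.ofReal t}

/-- The injectivity radius at `X`: the infimum, over the unit tangent vectors `ξ` at `X`, of the
cut time of the geodesic `γ` with `γ(0) = X` and `γ'(0) = ξ`. -/
def injRadiusAt {n p : ℕ} (β : ℝ) (X : Matrix (Fin n) (Fin p) ℝ) : ℝ≥0∞ :=
  sInf {r | ∃ ξ ∈ unitTangent β X, ∃ γ : ℝ → Matrix (Fin n) (Fin p) ℝ,
    IsGeodesic β γ ∧ γ 0 = X ∧ deriv γ 0 = ξ ∧ r = cutTime β γ}

/-- The injectivity radius of `St_β(n,p)`. -/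
def injRadius (n p : ℕ) (β : ℝ) : ℝ≥0∞ :=
  sInf {r | ∃ X ∈ stiefel n p, r = injRadiusAt β X}

end

end StiefelInj

namespace StiefelInj

noncomputable section

open scoped ENNReal ContDiff

attribute [local instance] Matrix.frobeniusNormedAddCommGroup Matrix.frobeniusNormedSpace

/-! ### Calculus of matrix-valued functions -/

/-- Matrix multiplication as a continuous bilinear map. -/
def mulCLM (l m n : ℕ) : Matrix (Fin l) (Fin m) ℝ →L[ℝ] Matrix (Fin m) (Fin n) ℝ →L[ℝ]
    Matrix (Fin l) (Fin n) ℝ :=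
  (LinearMap.mk₂ ℝ (fun A B => A * B) Matrix.add_mul (fun _ _ _ => Matrix.smul_mul _ _ _)
    Matrix.mul_add (fun _ _ _ => Matrix.mul_smul _ _ _)).toContinuousBilinearMap

/-- Matrix transposition as a continuous linear map. -/
def transposeCLM (m n : ℕ) : Matrix (Fin m) (Fin n) ℝ →L[ℝ] Matrix (Fin n) (Fin m) ℝ :=
  (Matrix.transposeLinearEquiv (Fin m) (Fin n) ℝ ℝ).toLinearMap.toContinuousLinearMap

/-- The trace as a continuous linear map. -/
def traceCLM (n : ℕ) : Matrix (Fin n) (Fin n) ℝ →L[ℝ] ℝ :=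
  (Matrix.traceLinearMap (Fin n) ℝ ℝ).toContinuousLinearMap

section

variable {l m n : ℕ}

theorem hasDerivAt_matrix_mul {f : ℝ → Matrix (Fin l) (Fin m) ℝ} {g : ℝ → Matrix (Fin m) (Fin n) ℝ}
    {f' : Matrix (Fin l) (Fin m) ℝ} {g' : Matrix (Fin m) (Fin n) ℝ} {t : ℝ}
    (hf : HasDerivAt f f' t) (hg : HasDerivAt g g' t) :
    HasDerivAt (fun s => f s * g s) (f t * g' + f' * g t) t := by
  have h := (((mulCLM l m n).isBoundedBilinearMap).hasFDerivAt (f t, g t)).comp_hasDerivAt t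
    (hf.prodMk hg)
  exact h

theorem hasDerivAt_matrix_transpose {f : ℝ → Matrix (Fin m) (Fin n) ℝ}
    {f' : Matrix (Fin m) (Fin n) ℝ} {t : ℝ} (hf : HasDerivAt f f' t) :
    HasDerivAt (fun s => (f s).transpose) f'.transpose t :=
  ((transposeCLM m n).hasFDerivAt (x := f t)).comp_hasDerivAt t hf

theorem hasDerivAt_matrix_trace {f : ℝ → Matrix (Fin n) (Fin n) ℝ}
    {f' : Matrix (Fin n) (Fin n) ℝ} {t : ℝ} (hf : HasDerivAt f f' t) :
    HasDerivAt (fun s => (f s).trace) f'.trace t :=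
  ((traceCLM n).hasFDerivAt (x := f t)).comp_hasDerivAt t hf

variable {E : Type*} [NormedAddCommGroup E] [NormedSpace ℝ E] {k : ℕ∞ω}

theorem contDiff_matrix_mul {f : E → Matrix (Fin l) (Fin m) ℝ}
    {g : E → Matrix (Fin m) (Fin n) ℝ} (hf : ContDiff ℝ k f) (hg : ContDiff ℝ k g) :
    ContDiff ℝ k (fun s => f s * g s) :=
  (((mulCLM l m n).isBoundedBilinearMap).contDiff).comp (hf.prodMk hg)

theorem contDiff_matrix_transpose {f : E → Matrix (Fin m) (Fin n) ℝ} (hf : ContDiff ℝ k f) :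
    ContDiff ℝ k (fun s => (f s).transpose) :=
  (transposeCLM m n).contDiff.comp hf

theorem contDiff_matrix_trace {f : E → Matrix (Fin n) (Fin n) ℝ} (hf : ContDiff ℝ k f) :
    ContDiff ℝ k (fun s => (f s).trace) :=
  (traceCLM n).contDiff.comp hf

theorem contDiff_metric {p : ℕ} (β : ℝ) {f g h : E → Matrix (Fin n) (Fin p) ℝ}
    (hf : ContDiff ℝ k f) (hg : ContDiff ℝ k g) (hh : ContDiff ℝ k h) :
    ContDiff ℝ k (fun s => metric β (f s) (g s) (h s)) := by
  unfold metric
  have hfT := contDiff_matrix_transpose hf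
  refine (contDiff_const.mul (contDiff_matrix_trace (contDiff_matrix_mul
    (contDiff_matrix_transpose (contDiff_matrix_mul hfT hg)) (contDiff_matrix_mul hfT hh)))).add ?_
  exact contDiff_matrix_trace (contDiff_matrix_mul (contDiff_matrix_mul
    (contDiff_matrix_transpose hg) (contDiff_const.sub (contDiff_matrix_mul hf hfT))) hh)

end

/-- Differentiation under the integral sign for a `C¹` integrand on a compact interval. -/
theorem hasDerivAt_integral_of_contDiff {F : ℝ × ℝ → ℝ} (hF : ContDiff ℝ 1 F) (a b s₀ : ℝ) :
    HasDerivAt (fun s => ∫ t in a..b, F (s, t))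
      (∫ t in a..b, fderiv ℝ F (s₀, t) (1, 0)) s₀ := by
  have hc : Continuous (fun z : ℝ × ℝ => fderiv ℝ F z (1, 0)) :=
    (hF.continuous_fderiv one_ne_zero).clm_apply continuous_const
  have hcompact := (isCompact_closedBall s₀ 1).prod (isCompact_uIcc (a := a) (b := b))
  obtain ⟨C, hC⟩ := hcompact.exists_bound_of_continuousOn hc.continuousOn
  refine (intervalIntegral.hasDerivAt_integral_of_dominated_loc_of_deriv_le
    (F' := fun s t => fderiv ℝ F (s, t) (1, 0)) (bound := fun _ => C)
    (Metric.closedBall_mem_nhds s₀ one_pos) ?_ ?_ ?_ ?_ ?_ ?_).2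
  · exact Filter.Eventually.of_forall fun s =>
      (hF.continuous.comp (Continuous.prodMk_right s)).aestronglyMeasurable
  · exact (hF.continuous.comp (Continuous.prodMk_right s₀)).intervalIntegrable _ _
  · exact (hc.comp (Continuous.prodMk_right s₀)).aestronglyMeasurable
  · exact Filter.Eventually.of_forall fun t ht s hs =>
      hC (s, t) ⟨hs, Set.uIoc_subset_uIcc ht⟩
  · exact intervalIntegrable_const
  · refine Filter.Eventually.of_forall fun t _ s _ => ?_
    have h := (hF.differentiable one_ne_zero (s, t)).hasFDerivAt.comp_hasDerivAt s
      ((hasDerivAt_id s).prodMk (hasDerivAt_const s t))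
    exact h

/-! ### A criterion for geodesics -/

theorem metric_self {n p : ℕ} (β : ℝ) (X ξ : Matrix (Fin n) (Fin p) ℝ) :
    metric β X ξ ξ = (ξ.transpose * ξ).trace
      + (β - 1) * ((X.transpose * ξ).transpose * (X.transpose * ξ)).trace := by
  have h : ξ.transpose * (1 - X * X.transpose) * ξ
      = ξ.transpose * ξ - (X.transpose * ξ).transpose * (X.transpose * ξ) := by
    simp only [Matrix.mul_sub, Matrix.sub_mul, Matrix.transpose_mul, Matrix.transpose_transpose,
      Matrix.mul_assoc, Matrix.mul_one]
  rw [metric, h, Matrix.trace_sub]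
  ring

theorem trace_symm_mul_skew {p : ℕ} {S B : Matrix (Fin p) (Fin p) ℝ} (hS : S.transpose = S)
    (hB : B + B.transpose = 0) : (S * B).trace = 0 := by
  have h : (S * B).trace = -(S * B).trace := by
    conv_lhs => rw [← Matrix.trace_transpose, Matrix.transpose_mul, hS, Matrix.trace_mul_comm,
      eq_neg_of_add_eq_zero_right hB]
    simp
  linarith

theorem trace_mul_symm_transpose_mul_tangent {n p : ℕ} {X V : Matrix (Fin n) (Fin p) ℝ}
    {S : Matrix (Fin p) (Fin p) ℝ} (hS : S.transpose = S) (hV : V ∈ tangentSpace X) :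
    ((X * S).transpose * V).trace = 0 := by
  rw [Matrix.transpose_mul, hS, Matrix.mul_assoc]
  refine trace_symm_mul_skew hS ?_
  rw [Matrix.transpose_mul, Matrix.transpose_transpose]
  exact hV

theorem mem_tangentSpace_of_hasDerivAt {n p : ℕ} {c : ℝ → Matrix (Fin n) (Fin p) ℝ}
    {V : Matrix (Fin n) (Fin p) ℝ} {s : ℝ} (hc : ∀ s, c s ∈ stiefel n p)
    (hV : HasDerivAt c V s) : V ∈ tangentSpace (c s) := by
  have h := hasDerivAt_matrix_mul (hasDerivAt_matrix_transpose hV) hV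
  have h' : (fun s => (c s).transpose * c s) = fun _ => 1 := funext hc
  rw [h'] at h
  exact h.unique (hasDerivAt_const s _)

theorem hasDerivAt_metric_self {n p : ℕ} (β : ℝ) {X ξ : ℝ → Matrix (Fin n) (Fin p) ℝ}
    {V W : Matrix (Fin n) (Fin p) ℝ} {s : ℝ} (hX : HasDerivAt X V s) (hξ : HasDerivAt ξ W s) :
    HasDerivAt (fun s => metric β (X s) (ξ s) (ξ s))
      (2 * (((ξ s).transpose * W).trace + (β - 1) * (((X s).transpose * ξ s).transpose
        * ((X s).transpose * W + V.transpose * ξ s)).trace)) s := by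
  have hsymm {m k : ℕ} (B C : Matrix (Fin m) (Fin k) ℝ) :
      (B.transpose * C + C.transpose * B).trace = 2 * (B.transpose * C).trace := by
    rw [Matrix.trace_add, ← Matrix.trace_transpose (C.transpose * B), Matrix.transpose_mul,
      Matrix.transpose_transpose]
    ring
  have hP := hasDerivAt_matrix_mul (hasDerivAt_matrix_transpose hX) hξ
  have h1 := hasDerivAt_matrix_trace
    (hasDerivAt_matrix_mul (hasDerivAt_matrix_transpose hξ) hξ)
  have h2 := hasDerivAt_matrix_trace
    (hasDerivAt_matrix_mul (hasDerivAt_matrix_transpose hP) hP)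
  simp only [metric_self]
  refine (h1.add (h2.const_mul (β - 1))).congr_deriv ?_
  rw [hsymm, hsymm]
  ring

/-- The partial derivatives of a smooth map on the plane, and the equality of the mixed ones. -/
theorem exists_partialDerivs {E : Type*} [NormedAddCommGroup E] [NormedSpace ℝ E]
    {G : ℝ × ℝ → E} (hG : ContDiff ℝ ∞ G) :
    ∃ Gs Gt Gst : ℝ × ℝ → E, ContDiff ℝ ∞ Gt ∧
      (∀ s t, HasDerivAt (fun s => G (s, t)) (Gs (s, t)) s) ∧
      (∀ s t, HasDerivAt (fun t => G (s, t)) (Gt (s, t)) t) ∧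
      (∀ s t, HasDerivAt (fun t => Gs (s, t)) (Gst (s, t)) t) ∧
      (∀ s t, HasDerivAt (fun s => Gt (s, t)) (Gst (s, t)) s) := by
  have hfd : ContDiff ℝ ∞ (fderiv ℝ G) := hG.fderiv_right (by simp)
  have hdiff := hG.differentiable (by simp)
  have hfdiff := hfd.differentiable (by simp)
  have hs (s t : ℝ) : HasDerivAt (fun s : ℝ => (s, t)) (1, 0) s :=
    (hasDerivAt_id s).prodMk (hasDerivAt_const s t)
  have ht (s t : ℝ) : HasDerivAt (fun t : ℝ => (s, t)) (0, 1) t :=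
    (hasDerivAt_const t s).prodMk (hasDerivAt_id t)
  refine ⟨fun z => fderiv ℝ G z (1, 0), fun z => fderiv ℝ G z (0, 1),
    fun z => fderiv ℝ (fderiv ℝ G) z (1, 0) (0, 1), hfd.clm_apply contDiff_const,
    fun s t => (hdiff (s, t)).hasFDerivAt.comp_hasDerivAt s (hs s t),
    fun s t => (hdiff (s, t)).hasFDerivAt.comp_hasDerivAt t (ht s t), fun s t => ?_, fun s t => ?_⟩
  · have hsym : fderiv ℝ (fderiv ℝ G) (s, t) (1, 0) (0, 1)
        = fderiv ℝ (fderiv ℝ G) (s, t) (0, 1) (1, 0) :=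
      (hG.contDiffAt.isSymmSndFDerivAt
        (by simpa using WithTop.coe_le_coe.2 (le_top : (2 : ℕ∞) ≤ ⊤))) _ _
    simp only [hsym]
    exact ((ContinuousLinearMap.apply ℝ _ ((1 : ℝ), (0 : ℝ))).hasFDerivAt).comp_hasDerivAt t
      ((hfdiff (s, t)).hasFDerivAt.comp_hasDerivAt t (ht s t))
  · exact ((ContinuousLinearMap.apply ℝ _ ((0 : ℝ), (1 : ℝ))).hasFDerivAt).comp_hasDerivAt s
      ((hfdiff (s, t)).hasFDerivAt.comp_hasDerivAt s (hs s t))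

/-- A curve in the Stiefel manifold with `γ'' = γ S`, `S` symmetric, and constant
`A = γᵀ γ'` satisfying `γ' A = γ A²` is a geodesic. -/
theorem isGeodesic_of_hasDerivAt {n p : ℕ} (β : ℝ) {γ γ' : ℝ → Matrix (Fin n) (Fin p) ℝ}
    {S A : Matrix (Fin p) (Fin p) ℝ} (hγ : ContDiff ℝ ∞ γ) (hmem : ∀ t, γ t ∈ stiefel n p)
    (hd : ∀ t, HasDerivAt γ (γ' t) t) (hd' : ∀ t, HasDerivAt γ' (γ t * S) t)
    (hS : S.transpose = S) (hA : A.transpose = -A) (hA' : ∀ t, (γ t).transpose * γ' t = A)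
    (hAA : ∀ t, γ' t * A = γ t * (A * A)) : IsGeodesic β γ := by
  refine ⟨hγ, hmem, fun a b _ Γ hΓ => ?_⟩
  have hG := hΓ.smooth
  set G : ℝ × ℝ → Matrix (Fin n) (Fin p) ℝ := fun z => Γ z.1 z.2 with hGdef
  obtain ⟨Gs, Gt, Gst, hGtc, hGs, hGt, hWt, hWs⟩ := exists_partialDerivs hG
  have hγΓ : Γ 0 = γ := funext hΓ.base
  have hξ : ∀ t, Gt (0, t) = γ' t := fun t => by
    have h : HasDerivAt (Γ 0) (Gt (0, t)) t := hGt 0 t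
    rw [hγΓ] at h
    exact h.unique (hd t)
  set F : ℝ × ℝ → ℝ := fun z => metric β (G z) (Gt z) (Gt z) with hFdef
  have hF1 : ContDiff ℝ 1 F := (contDiff_metric β hG hGtc hGtc).of_le (by simp)
  have hE : (fun s => curveEnergy β (Γ s) a b) = fun s => (1 / 2) * ∫ t in a..b, F (s, t) := by
    funext s
    have h : ∀ t, deriv (Γ s) t = Gt (s, t) := fun t => HasDerivAt.deriv (hGt s t)
    simp only [curveEnergy, h, hFdef, hGdef]
  rw [hE]
  have hI := (hasDerivAt_integral_of_contDiff hF1 a b 0).const_mul (1 / 2)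
  set V : ℝ → Matrix (Fin n) (Fin p) ℝ := fun t => Gs (0, t) with hVdef
  have hVtan : ∀ t, V t ∈ tangentSpace (γ t) := fun t => by
    have := mem_tangentSpace_of_hasDerivAt (fun s => hΓ.mem s t) (hGs 0 t)
    rwa [hΓ.base] at this
  have hVa : V a = 0 :=
    (hGs 0 a).unique ((funext hΓ.left : (fun s => Γ s a) = fun _ => γ a) ▸ hasDerivAt_const 0 (γ a))
  have hVb : V b = 0 :=
    (hGs 0 b).unique
      ((funext hΓ.right : (fun s => Γ s b) = fun _ => γ b) ▸ hasDerivAt_const 0 (γ b))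
  set Φ : ℝ → ℝ := fun t => 2 * ((γ' t + (β - 1) • (γ t * A)).transpose * V t).trace with hΦdef
  have hAsq : (A * A).transpose = A * A := by rw [Matrix.transpose_mul, hA]; simp
  have hΦ : ∀ t, HasDerivAt Φ (fderiv ℝ F (0, t) (1, 0)) t := fun t => by
    have hline : HasDerivAt (fun s : ℝ => (s, t)) (1, 0) 0 :=
      (hasDerivAt_id (0 : ℝ)).prodMk (hasDerivAt_const (0 : ℝ) t)
    have hFs : HasDerivAt (fun s => F (s, t)) (fderiv ℝ F (0, t) (1, 0)) 0 := by
      have hFd : HasFDerivAt F (fderiv ℝ F (0, t)) (0, t) :=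
        ((hF1.differentiable one_ne_zero) (0, t)).hasFDerivAt
      exact hFd.comp_hasDerivAt (0 : ℝ) hline
    have hFs' := hFs.unique (hasDerivAt_metric_self β (hGs 0 t) (hWs 0 t))
    have hbase : G (0, t) = γ t := hΓ.base t
    rw [hFs', hξ, hbase, hA']
    have hγA : HasDerivAt (fun t => γ t * A) (γ' t * A) t := by
      simpa using hasDerivAt_matrix_mul (hd t) (hasDerivAt_const t A)
    have h := (hasDerivAt_matrix_trace (hasDerivAt_matrix_mul (hasDerivAt_matrix_transpose
      ((hd' t).add (hγA.const_smul (β - 1)))) (hWt 0 t))).const_mul 2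
    refine h.congr_deriv ?_
    have e1 := trace_mul_symm_transpose_mul_tangent hS (hVtan t)
    have e2 := trace_mul_symm_transpose_mul_tangent hAsq (hVtan t)
    rw [← hAA] at e2
    have e3 : (A.transpose * ((V t).transpose * γ' t)).trace = 0 := by
      rw [hA, Matrix.neg_mul, Matrix.trace_neg, neg_eq_zero, Matrix.trace_mul_comm,
        Matrix.mul_assoc, ← Matrix.trace_transpose, Matrix.transpose_mul,
        Matrix.transpose_transpose]
      exact e2
    have hVt : Gs (0, t) = V t := rfl
    rw [hVt]
    simp only [Pi.add_apply, Pi.smul_apply, Matrix.transpose_add, Matrix.transpose_smul,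
      Matrix.add_mul, Matrix.smul_mul, Matrix.mul_add, Matrix.trace_add, Matrix.trace_smul,
      smul_eq_mul, e1, e2, e3]
    simp only [Matrix.transpose_mul, Matrix.mul_assoc]
    change _ = 2 * _
    ring
  have hint : ∫ t in a..b, fderiv ℝ F (0, t) (1, 0) = 0 := by
    rw [intervalIntegral.integral_eq_sub_of_hasDerivAt (fun t _ => hΦ t)]
    · simp [hΦdef, hVa, hVb]
    · exact (((hF1.continuous_fderiv one_ne_zero).comp (Continuous.prodMk_right 0)).clm_apply
        continuous_const).intervalIntegrable _ _
  rw [hint, mul_zero] at hI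
  exact hI

/-! ### An isometric embedding of `St(4,2)` into `St(n,p)` -/

/-- The data of an isometric embedding `N ↦ U N Wᵀ + R` of `St(4,2)` into `St(n,p)`. -/
structure Frame (n p : ℕ) where
  U : Matrix (Fin n) (Fin 4) ℝ
  W : Matrix (Fin p) (Fin 2) ℝ
  R : Matrix (Fin n) (Fin p) ℝ
  U_orth : U.transpose * U = 1
  W_orth : W.transpose * W = 1
  U_R : U.transpose * R = 0
  R_R : R.transpose * R = 1 - W * W.transpose
  R_W : R * W = 0

theorem nonempty_frame {n p : ℕ} (hp : 2 ≤ p) (hpn : p + 2 ≤ n) : Nonempty (Frame n p) := by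
  let e : Fin 4 → Fin n := ![⟨0, by omega⟩, ⟨1, by omega⟩, ⟨p, by omega⟩, ⟨p + 1, by omega⟩]
  have he : ∀ k, (e k : ℕ) < 2 ∨ p ≤ (e k : ℕ) := by
    intro k; fin_cases k <;> simp [e]
  have hinj : Function.Injective e := by
    intro k l h
    fin_cases k <;> fin_cases l <;> simp [e] at h ⊢ <;> omega
  have hinj' : Function.Injective (Fin.castLE hp) := Fin.castLE_injective hp
  have orth {m k : ℕ} (f : Fin m → Fin k) (hf : Function.Injective f) :
      ((1 : Matrix (Fin k) (Fin k) ℝ).submatrix id f).transpose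
        * (1 : Matrix (Fin k) (Fin k) ℝ).submatrix id f = 1 := by
    rw [Matrix.transpose_submatrix, ← Matrix.submatrix_mul _ _ _ _ _ Function.bijective_id]
    simp [Matrix.submatrix_one f hf]
  refine ⟨⟨(1 : Matrix (Fin n) (Fin n) ℝ).submatrix id e,
    (1 : Matrix (Fin p) (Fin p) ℝ).submatrix id (Fin.castLE hp),
    Matrix.of fun i j => if (i : ℕ) = j ∧ 2 ≤ (j : ℕ) then 1 else 0, orth e hinj, orth _ hinj',
    ?_, ?_, ?_⟩⟩
  · ext k j
    simp only [Matrix.mul_apply, Matrix.transpose_apply, Matrix.submatrix_apply, id,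
      Matrix.one_apply, Matrix.of_apply, Matrix.zero_apply]
    refine Finset.sum_eq_zero fun i _ => ?_
    have := he k
    split_ifs with h1 h2
    · subst h1; omega
    all_goals simp
  · ext j l
    have hsum : ∑ i : Fin n, (if (i : ℕ) = j ∧ 2 ≤ (j : ℕ) then (1 : ℝ) else 0)
        * (if (i : ℕ) = l ∧ 2 ≤ (l : ℕ) then (1 : ℝ) else 0)
        = if j = l ∧ 2 ≤ (j : ℕ) then 1 else 0 := by
      rw [Finset.sum_eq_single (⟨j, by omega⟩ : Fin n)]
      · by_cases h : j = l
        · subst h; simp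
        · have : (j : ℕ) ≠ l := fun h' => h (Fin.ext h')
          simp [h, this]
      · intro i _ hi
        have : (i : ℕ) ≠ j := fun h' => hi (Fin.ext h')
        simp [this]
      · simp
    simp only [Matrix.mul_apply, Matrix.transpose_apply, Matrix.submatrix_apply, id,
      Matrix.one_apply, Matrix.of_apply, Matrix.sub_apply, hsum, Fin.sum_univ_two, Fin.ext_iff,
      Fin.val_castLE, Fin.val_zero, Fin.val_one]
    split_ifs <;> first | omega | simp
  · ext i k
    simp only [Matrix.mul_apply, Matrix.submatrix_apply, id,
      Matrix.one_apply, Matrix.of_apply, Matrix.zero_apply]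
    refine Finset.sum_eq_zero fun j _ => ?_
    split_ifs with h1 h2
    · subst h2
      have := k.2
      simp at h1
      omega
    all_goals simp

variable {n p : ℕ}

namespace Frame

/-- The linear part `ξ ↦ U ξ Wᵀ` of the embedding. -/
def lin (F : Frame n p) (ξ : Matrix (Fin 4) (Fin 2) ℝ) : Matrix (Fin n) (Fin p) ℝ :=
  F.U * ξ * F.W.transpose

/-- The embedding `N ↦ U N Wᵀ + R`. -/
def embed (F : Frame n p) (N : Matrix (Fin 4) (Fin 2) ℝ) : Matrix (Fin n) (Fin p) ℝ :=
  F.lin N + F.R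

variable (F : Frame n p)

theorem R_transpose_U : F.R.transpose * F.U = 0 := by
  have := congrArg Matrix.transpose F.U_R
  simpa [Matrix.transpose_mul] using this

theorem lin_transpose_mul_lin (N ξ : Matrix (Fin 4) (Fin 2) ℝ) :
    (F.lin N).transpose * F.lin ξ = F.W * (N.transpose * ξ) * F.W.transpose := by
  have h : ∀ B : Matrix (Fin 4) (Fin p) ℝ, F.U.transpose * (F.U * B) = B := fun B => by
    rw [← Matrix.mul_assoc, F.U_orth, Matrix.one_mul]
  simp only [lin, Matrix.transpose_mul, Matrix.transpose_transpose, Matrix.mul_assoc, h]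

theorem embed_transpose_mul_lin (N ξ : Matrix (Fin 4) (Fin 2) ℝ) :
    (F.embed N).transpose * F.lin ξ = F.W * (N.transpose * ξ) * F.W.transpose := by
  rw [embed, Matrix.transpose_add, Matrix.add_mul, lin_transpose_mul_lin]
  simp only [lin]
  rw [Matrix.mul_assoc F.U, ← Matrix.mul_assoc F.R.transpose, R_transpose_U]
  simp

theorem embed_mem {N : Matrix (Fin 4) (Fin 2) ℝ} (hN : N ∈ stiefel 4 2) :
    F.embed N ∈ stiefel n p := by
  have hN' : N.transpose * N = 1 := hN
  change (F.embed N).transpose * F.embed N = 1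
  have hLR : (F.lin N).transpose * F.R = 0 := by
    simp only [lin, Matrix.transpose_mul, Matrix.mul_assoc, F.U_R, Matrix.mul_zero]
  conv_lhs => rw [embed, Matrix.mul_add]
  rw [← embed, embed_transpose_mul_lin, hN', embed, Matrix.transpose_add, Matrix.add_mul, hLR,
    F.R_R]
  simp

theorem W_transpose_mul (B : Matrix (Fin 2) (Fin p) ℝ) : F.W.transpose * (F.W * B) = B := by
  rw [← Matrix.mul_assoc, F.W_orth, Matrix.one_mul]

theorem lin_mul (N : Matrix (Fin 4) (Fin 2) ℝ) (S : Matrix (Fin 2) (Fin 2) ℝ) :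
    F.lin N * (F.W * S * F.W.transpose) = F.lin (N * S) := by
  simp only [lin, Matrix.mul_assoc, W_transpose_mul]

theorem embed_mul (N : Matrix (Fin 4) (Fin 2) ℝ) (S : Matrix (Fin 2) (Fin 2) ℝ) :
    F.embed N * (F.W * S * F.W.transpose) = F.lin (N * S) := by
  rw [embed, Matrix.add_mul, lin_mul, ← Matrix.mul_assoc, ← Matrix.mul_assoc, F.R_W]
  simp

theorem trace_conj (B : Matrix (Fin 2) (Fin 2) ℝ) :
    (F.W * B * F.W.transpose).trace = B.trace := by
  rw [Matrix.mul_assoc, Matrix.trace_mul_comm, Matrix.mul_assoc, F.W_orth, Matrix.mul_one]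

theorem metric_embed (β : ℝ) (N ξ : Matrix (Fin 4) (Fin 2) ℝ) :
    metric β (F.embed N) (F.lin ξ) (F.lin ξ) = metric β N ξ ξ := by
  rw [metric_self, metric_self, embed_transpose_mul_lin, lin_transpose_mul_lin, trace_conj]
  congr 2
  rw [← F.trace_conj ((N.transpose * ξ).transpose * (N.transpose * ξ))]
  simp only [Matrix.transpose_mul, Matrix.transpose_transpose, Matrix.mul_assoc, W_transpose_mul]

/-- The linear part of the embedding as a continuous linear map. -/
def linCLM : Matrix (Fin 4) (Fin 2) ℝ →L[ℝ] Matrix (Fin n) (Fin p) ℝ :=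
  LinearMap.toContinuousLinearMap
    { toFun := F.lin
      map_add' := fun x y => by simp [lin, Matrix.mul_add, Matrix.add_mul]
      map_smul' := fun c x => by simp [lin] }

theorem hasDerivAt_lin {c : ℝ → Matrix (Fin 4) (Fin 2) ℝ} {c' : Matrix (Fin 4) (Fin 2) ℝ} {t : ℝ}
    (hc : HasDerivAt c c' t) : HasDerivAt (fun t => F.lin (c t)) (F.lin c') t :=
  (F.linCLM.hasFDerivAt (x := c t)).comp_hasDerivAt t hc

theorem hasDerivAt_embed {c : ℝ → Matrix (Fin 4) (Fin 2) ℝ} {c' : Matrix (Fin 4) (Fin 2) ℝ}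
    {t : ℝ} (hc : HasDerivAt c c' t) : HasDerivAt (fun t => F.embed (c t)) (F.lin c') t :=
  (F.hasDerivAt_lin hc).add_const F.R

theorem contDiff_embed {c : ℝ → Matrix (Fin 4) (Fin 2) ℝ} {k : ℕ∞ω}
    (hc : ContDiff ℝ k c) : ContDiff ℝ k (fun t => F.embed (c t)) :=
  (F.linCLM.contDiff.comp hc).add contDiff_const

theorem isGeodesic_embed (β : ℝ) {N N' : ℝ → Matrix (Fin 4) (Fin 2) ℝ}
    {S A : Matrix (Fin 2) (Fin 2) ℝ} (hN : ContDiff ℝ ∞ N) (hmem : ∀ t, N t ∈ stiefel 4 2)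
    (hd : ∀ t, HasDerivAt N (N' t) t) (hd' : ∀ t, HasDerivAt N' (N t * S) t)
    (hS : S.transpose = S) (hA : A.transpose = -A) (hA' : ∀ t, (N t).transpose * N' t = A)
    (hAA : ∀ t, N' t * A = N t * (A * A)) : IsGeodesic β (fun t => F.embed (N t)) := by
  refine isGeodesic_of_hasDerivAt β (γ' := fun t => F.lin (N' t)) (S := F.W * S * F.W.transpose)
    (A := F.W * A * F.W.transpose) (F.contDiff_embed hN) (fun t => F.embed_mem (hmem t))
    (fun t => F.hasDerivAt_embed (hd t)) (fun t => ?_) ?_ ?_ (fun t => ?_) (fun t => ?_)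
  · rw [embed_mul]
    exact F.hasDerivAt_lin (hd' t)
  · simp only [Matrix.transpose_mul, Matrix.transpose_transpose, hS, Matrix.mul_assoc]
  · simp only [Matrix.transpose_mul, Matrix.transpose_transpose, hA, Matrix.mul_assoc,
      Matrix.neg_mul, Matrix.mul_neg]
  · rw [embed_transpose_mul_lin, hA']
  · have h : F.W * A * F.W.transpose * (F.W * A * F.W.transpose)
        = F.W * (A * A) * F.W.transpose := by
      simp only [Matrix.mul_assoc, W_transpose_mul]
    rw [h, embed_mul, lin_mul, hAA]

theorem stiefelDist_embed_le (β : ℝ) {c c' : ℝ → Matrix (Fin 4) (Fin 2) ℝ} (hc : ContDiff ℝ 1 c)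
    (hmem : ∀ t, c t ∈ stiefel 4 2) (hd : ∀ t, HasDerivAt c (c' t) t) {a b : ℝ} (hab : a ≤ b) :
    stiefelDist β (F.embed (c a)) (F.embed (c b))
      ≤ ENNReal.ofReal (∫ t in a..b, Real.sqrt (metric β (c t) (c' t) (c' t))) := by
  refine sInf_le ⟨fun t => F.embed (c t), a, b, hab, ⟨fun t _ => F.embed_mem (hmem t), 1,
    fun k => if k = 0 then a else b, ?_, by simp, by simp, fun k _ =>
      (F.contDiff_embed hc).contDiffOn⟩, rfl, rfl, ?_⟩
  · refine monotone_nat_of_le_succ fun k => ?_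
    rcases Nat.eq_zero_or_pos k with rfl | hk
    · simpa using hab
    · simp [hk.ne']
  · have h : ∀ t, deriv (fun t => F.embed (c t)) t = F.lin (c' t) := fun t =>
      (F.hasDerivAt_embed (hd t)).deriv
    simp only [curveLength, h, metric_embed]

end Frame

/-! ### Bounding the injectivity radius by a geodesic in the image of the embedding -/

theorem cutTime_le {β T : ℝ} {γ : ℝ → Matrix (Fin n) (Fin p) ℝ}
    (h : ∀ t, T < t → stiefelDist β (γ 0) (γ t) < ENNReal.ofReal t) :
    cutTime β γ ≤ ENNReal.ofReal T := by
  refine sSup_le ?_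
  rintro r ⟨t, _, hdist, rfl⟩
  by_contra hlt
  have : T < t := lt_of_not_ge fun htT => hlt (ENNReal.ofReal_le_ofReal htT)
  exact (h t this).ne hdist

theorem injRadius_le_cutTime {β : ℝ} {γ : ℝ → Matrix (Fin n) (Fin p) ℝ} (hγ : IsGeodesic β γ)
    (hunit : metric β (γ 0) (deriv γ 0) (deriv γ 0) = 1) :
    injRadius n p β ≤ cutTime β γ := by
  have htan : deriv γ 0 ∈ tangentSpace (γ 0) :=
    mem_tangentSpace_of_hasDerivAt hγ.mem (hγ.smooth.differentiable (by simp) 0).hasDerivAt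
  refine (sInf_le ⟨γ 0, hγ.mem 0, rfl⟩ : injRadius n p β ≤ injRadiusAt β (γ 0)).trans ?_
  exact sInf_le ⟨deriv γ 0, ⟨htan, hunit⟩, γ, hγ, rfl, rfl, rfl⟩

theorem metric_smul_smul (β c : ℝ) (X ξ : Matrix (Fin n) (Fin p) ℝ) :
    metric β X (c • ξ) (c • ξ) = c ^ 2 * metric β X ξ ξ := by
  simp only [metric, Matrix.transpose_smul, Matrix.mul_smul, Matrix.smul_mul, Matrix.trace_smul,
    smul_eq_mul]
  ring

/-- The curve `θ ↦ cos θ • P + sin θ • Q + Z`. -/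
def circ (P Q Z : Matrix (Fin n) (Fin p) ℝ) (θ : ℝ) : Matrix (Fin n) (Fin p) ℝ :=
  Real.cos θ • P + Real.sin θ • Q + Z

theorem contDiff_circ (P Q Z : Matrix (Fin n) (Fin p) ℝ) {k : ℕ∞ω} :
    ContDiff ℝ k (circ P Q Z) :=
  ((Real.contDiff_cos.smul contDiff_const).add
    (Real.contDiff_sin.smul contDiff_const)).add contDiff_const

theorem hasDerivAt_circ (P Q Z : Matrix (Fin n) (Fin p) ℝ) (c t : ℝ) :
    HasDerivAt (fun t => circ P Q Z (c * t)) (c • circ Q (-P) 0 (c * t)) t := by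
  have hc : HasDerivAt (fun t => c * t) c t := by simpa using (hasDerivAt_id t).const_mul c
  have h := ((hc.cos.smul_const P).add (hc.sin.smul_const Q)).add_const Z
  refine h.congr_deriv ?_
  simp only [circ]
  module

/-- A great-circle geodesic `θ ↦ cos θ • P + sin θ • Q + Z` of constant squared speed `v` that
stops minimizing after the angle `T ≤ π` bounds the injectivity radius by `√v T`. -/
theorem injRadius_le_of_circ (F : Frame n p) {β v T : ℝ} (hv : 0 < v)
    {P Q Z : Matrix (Fin 4) (Fin 2) ℝ} {S A : Matrix (Fin 2) (Fin 2) ℝ}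
    (hmem : ∀ θ, circ P Q Z θ ∈ stiefel 4 2)
    (hS : S.transpose = S) (hcS : ∀ θ, circ P Q 0 θ = circ P Q Z θ * S)
    (hA : A.transpose = -A) (hA' : ∀ θ, (circ P Q Z θ).transpose * circ Q (-P) 0 θ = A)
    (hAA : ∀ θ, circ Q (-P) 0 θ * A = circ P Q Z θ * (A * A))
    (hmet : ∀ θ, metric β (circ P Q Z θ) (circ Q (-P) 0 θ) (circ Q (-P) 0 θ) = v)
    (hmin : ∀ θ, T < θ → θ ≤ Real.pi →
      stiefelDist β (F.embed (circ P Q Z 0)) (F.embed (circ P Q Z θ))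
        < ENNReal.ofReal (Real.sqrt v * θ)) :
    injRadius n p β ≤ ENNReal.ofReal (Real.sqrt v * T) := by
  have hsv : 0 < Real.sqrt v := Real.sqrt_pos.2 hv
  set c := (Real.sqrt v)⁻¹ with hcdef
  have hcv : c ^ 2 * v = 1 := by
    rw [hcdef, inv_pow, Real.sq_sqrt hv.le, inv_mul_cancel₀ hv.ne']
  have hgeo : IsGeodesic β (fun t => F.embed (circ P Q Z (c * t))) := by
    refine F.isGeodesic_embed β (N' := fun t => c • circ Q (-P) 0 (c * t)) (S := (-c ^ 2) • S)
      (A := c • A) ?_ (fun t => hmem _) (hasDerivAt_circ P Q Z c) (fun t => ?_) ?_ ?_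
      (fun t => ?_) (fun t => ?_)
    · exact (contDiff_circ P Q Z).comp (contDiff_const.mul contDiff_id)
    · have h := (hasDerivAt_circ Q (-P) 0 c t).const_smul c
      refine h.congr_deriv ?_
      rw [Matrix.mul_smul, ← hcS]
      simp only [circ]
      module
    · rw [Matrix.transpose_smul, hS]
    · rw [Matrix.transpose_smul, hA, smul_neg]
    · rw [Matrix.mul_smul, hA']
    · rw [Matrix.smul_mul, Matrix.mul_smul, hAA, Matrix.smul_mul, Matrix.mul_smul,
        Matrix.mul_smul, Matrix.mul_smul]
  have hder : deriv (fun t => F.embed (circ P Q Z (c * t))) 0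
      = F.lin (c • circ Q (-P) 0 (c * 0)) := (F.hasDerivAt_embed (hasDerivAt_circ P Q Z c 0)).deriv
  refine (injRadius_le_cutTime hgeo ?_).trans (cutTime_le fun t ht => ?_)
  · rw [hder, F.metric_embed, metric_smul_smul, hmet, hcv]
  have hθ : T < c * t := by
    rw [hcdef, ← div_eq_inv_mul, lt_div_iff₀' hsv]
    exact ht
  have ht' : t = Real.sqrt v * (c * t) := by
    rw [← mul_assoc, hcdef, mul_inv_cancel₀ hsv.ne', one_mul]
  simp only [mul_zero]
  generalize c * t = θ at hθ ht'
  subst ht'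
  rcases le_or_gt θ Real.pi with hπ | hπ
  · exact hmin θ hθ hπ
  obtain ⟨φ, hφ, hper⟩ : ∃ φ : ℝ, |φ| ≤ Real.pi ∧ circ P Q Z θ = circ P Q Z φ := by
    refine ⟨toIocMod Real.two_pi_pos (-Real.pi) θ, ?_, ?_⟩
    · have h := toIocMod_mem_Ioc Real.two_pi_pos (-Real.pi) θ
      exact abs_le.2 ⟨h.1.le, by linarith [h.2]⟩
    · have h := toIocMod_add_toIocDiv_zsmul Real.two_pi_pos (-Real.pi) θ
      rw [zsmul_eq_mul] at h
      conv_lhs => rw [← h]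
      simp only [circ, Real.cos_add_int_mul_two_pi, Real.sin_add_int_mul_two_pi]
  obtain ⟨ε, hε, hεφ⟩ : ∃ ε : ℝ, ε ^ 2 = 1 ∧ φ = ε * |φ| := by
    rcases abs_choice φ with h | h
    · exact ⟨1, by norm_num, by rw [h]; ring⟩
    · exact ⟨-1, by norm_num, by rw [h]; ring⟩
  have hsmooth : ContDiff ℝ 1 (fun t => circ P Q Z (ε * t)) :=
    (contDiff_circ P Q Z).comp (contDiff_const.mul contDiff_id)
  have hθpos : 0 < θ := Real.pi_pos.trans hπ
  have hle := F.stiefelDist_embed_le β hsmooth (fun t => hmem _)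
    (hasDerivAt_circ P Q Z ε) (abs_nonneg φ)
  simp only [metric_smul_smul, hmet, hε, one_mul, intervalIntegral.integral_const, sub_zero,
    smul_eq_mul, mul_zero, ← hεφ] at hle
  rw [hper]
  refine hle.trans_lt ((ENNReal.ofReal_lt_ofReal_iff (by positivity)).2 ?_)
  rw [mul_comm]
  exact mul_lt_mul_of_pos_left (hφ.trans_lt hπ) hsv

/-! ### A totally geodesic Berger sphere in `St(4,2)` -/

/-- The matrix of the pair of complex numbers `(u₁ + i u₂, v₁ + i v₂)`, each written as a real
`2 × 2` block. -/
def berger (u₁ u₂ v₁ v₂ : ℝ) : Matrix (Fin 4) (Fin 2) ℝ :=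
  !![u₁, -u₂; u₂, u₁; v₁, -v₂; v₂, v₁]

theorem berger_mem {u₁ u₂ v₁ v₂ : ℝ} (h : u₁ ^ 2 + u₂ ^ 2 + v₁ ^ 2 + v₂ ^ 2 = 1) :
    berger u₁ u₂ v₁ v₂ ∈ stiefel 4 2 := by
  change (berger u₁ u₂ v₁ v₂).transpose * berger u₁ u₂ v₁ v₂ = 1
  ext i j
  fin_cases i <;> fin_cases j <;>
    simp [berger, Matrix.mul_apply, Fin.sum_univ_four] <;> linarith

theorem metric_berger (β u₁ u₂ v₁ v₂ x₁ x₂ y₁ y₂ : ℝ) :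
    metric β (berger u₁ u₂ v₁ v₂) (berger x₁ x₂ y₁ y₂) (berger x₁ x₂ y₁ y₂)
      = 2 * ((x₁ ^ 2 + x₂ ^ 2 + y₁ ^ 2 + y₂ ^ 2) + (β - 1) *
        ((u₁ * x₁ + u₂ * x₂ + v₁ * y₁ + v₂ * y₂) ^ 2
          + (u₁ * x₂ - u₂ * x₁ + v₁ * y₂ - v₂ * y₁) ^ 2)) := by
  rw [metric_self]
  simp [berger, Matrix.trace, Matrix.mul_apply, Fin.sum_univ_four, Fin.sum_univ_two]
  ring

theorem berger_eq_sum (u₁ u₂ v₁ v₂ : ℝ) : berger u₁ u₂ v₁ v₂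
    = u₁ • berger 1 0 0 0 + u₂ • berger 0 1 0 0 + v₁ • berger 0 0 1 0 + v₂ • berger 0 0 0 1 := by
  ext i j
  fin_cases i <;> fin_cases j <;> simp [berger]

theorem hasDerivAt_berger {u₁ u₂ v₁ v₂ : ℝ → ℝ} {x₁ x₂ y₁ y₂ t : ℝ} (hu₁ : HasDerivAt u₁ x₁ t)
    (hu₂ : HasDerivAt u₂ x₂ t) (hv₁ : HasDerivAt v₁ y₁ t) (hv₂ : HasDerivAt v₂ y₂ t) :
    HasDerivAt (fun t => berger (u₁ t) (u₂ t) (v₁ t) (v₂ t)) (berger x₁ x₂ y₁ y₂) t := by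
  rw [funext fun t => berger_eq_sum (u₁ t) (u₂ t) (v₁ t) (v₂ t), berger_eq_sum x₁]
  exact (((hu₁.smul_const _).add (hu₂.smul_const _)).add (hv₁.smul_const _)).add
    (hv₂.smul_const _)

theorem contDiff_berger {u₁ u₂ v₁ v₂ : ℝ → ℝ} {k : ℕ∞ω} (hu₁ : ContDiff ℝ k u₁)
    (hu₂ : ContDiff ℝ k u₂) (hv₁ : ContDiff ℝ k v₁) (hv₂ : ContDiff ℝ k v₂) :
    ContDiff ℝ k (fun t => berger (u₁ t) (u₂ t) (v₁ t) (v₂ t)) := by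
  rw [funext fun t => berger_eq_sum (u₁ t) (u₂ t) (v₁ t) (v₂ t)]
  exact (((hu₁.smul contDiff_const).add (hu₂.smul contDiff_const)).add
    (hv₁.smul contDiff_const)).add (hv₂.smul contDiff_const)

/-- The speed of a normalized curve `ρ y` with `ρ = |y|⁻¹` in the Berger sphere. -/
theorem metric_berger_normalized (β ρ u₁ u₂ v₁ v₂ x₁ x₂ y₁ y₂ N M D θ : ℝ)
    (hN : u₁ ^ 2 + u₂ ^ 2 + v₁ ^ 2 + v₂ ^ 2 = N) (hM : x₁ ^ 2 + x₂ ^ 2 + y₁ ^ 2 + y₂ ^ 2 = M)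
    (hD : u₁ * x₁ + u₂ * x₂ + v₁ * y₁ + v₂ * y₂ = D)
    (hθ : u₁ * x₂ - u₂ * x₁ + v₁ * y₂ - v₂ * y₁ = θ) (hρ : ρ ^ 2 * N = 1) :
    metric β (berger (ρ * u₁) (ρ * u₂) (ρ * v₁) (ρ * v₂))
      (berger (-(ρ ^ 3 * D) * u₁ + ρ * x₁) (-(ρ ^ 3 * D) * u₂ + ρ * x₂)
        (-(ρ ^ 3 * D) * v₁ + ρ * y₁) (-(ρ ^ 3 * D) * v₂ + ρ * y₂))
      (berger (-(ρ ^ 3 * D) * u₁ + ρ * x₁) (-(ρ ^ 3 * D) * u₂ + ρ * x₂)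
        (-(ρ ^ 3 * D) * v₁ + ρ * y₁) (-(ρ ^ 3 * D) * v₂ + ρ * y₂))
      = 2 * ((N * M - D ^ 2 + (β - 1) * θ ^ 2) / N ^ 2) := by
  have hN0 : N ≠ 0 := fun h => by simp [h] at hρ
  have hdiv : (N * M - D ^ 2 + (β - 1) * θ ^ 2) / N ^ 2
      = ρ ^ 4 * (N * M - D ^ 2 + (β - 1) * θ ^ 2) := by
    rw [div_eq_iff (by positivity)]
    linear_combination (-(N * M - D ^ 2 + (β - 1) * θ ^ 2) * (ρ ^ 2 * N + 1)) * hρ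
  rw [metric_berger, hdiv]
  have e1 : (-(ρ ^ 3 * D) * u₁ + ρ * x₁) ^ 2 + (-(ρ ^ 3 * D) * u₂ + ρ * x₂) ^ 2
      + (-(ρ ^ 3 * D) * v₁ + ρ * y₁) ^ 2 + (-(ρ ^ 3 * D) * v₂ + ρ * y₂) ^ 2
      = ρ ^ 6 * D ^ 2 * N - 2 * ρ ^ 4 * D ^ 2 + ρ ^ 2 * M := by
    linear_combination (ρ ^ 6 * D ^ 2) * hN - (2 * ρ ^ 4 * D) * hD + ρ ^ 2 * hM
  have e2 : ρ * u₁ * (-(ρ ^ 3 * D) * u₁ + ρ * x₁) + ρ * u₂ * (-(ρ ^ 3 * D) * u₂ + ρ * x₂)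
      + ρ * v₁ * (-(ρ ^ 3 * D) * v₁ + ρ * y₁) + ρ * v₂ * (-(ρ ^ 3 * D) * v₂ + ρ * y₂) = 0 := by
    linear_combination (-ρ ^ 4 * D) * hN + ρ ^ 2 * hD - (ρ ^ 2 * D) * hρ
  have e3 : ρ * u₁ * (-(ρ ^ 3 * D) * u₂ + ρ * x₂) - ρ * u₂ * (-(ρ ^ 3 * D) * u₁ + ρ * x₁)
      + ρ * v₁ * (-(ρ ^ 3 * D) * v₂ + ρ * y₂) - ρ * v₂ * (-(ρ ^ 3 * D) * v₁ + ρ * y₁)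
      = ρ ^ 2 * θ := by
    linear_combination ρ ^ 2 * hθ
  rw [e1, e2, e3]
  linear_combination (2 * (ρ ^ 4 * D ^ 2 - ρ ^ 2 * M)) * hρ

/-- The squared speed, up to the factor `2`, of the variation of the horizontal great circle by
the fields `a` (vertical) and `b` (horizontal) at parameter `s`. -/
def varSpeed (β s a b a' b' : ℝ) : ℝ :=
  (β * s ^ 2 * (a' + 2 * b) ^ 2 + s ^ 2 * (b' - 2 * a) ^ 2
    + (1 - s ^ 2 * (a ^ 2 + b ^ 2 - (a * b' - b * a'))) ^ 2) / (1 + s ^ 2 * (a ^ 2 + b ^ 2)) ^ 2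

theorem varSpeed_nonneg {β : ℝ} (hβ : 0 < β) (s a b a' b' : ℝ) :
    0 ≤ varSpeed β s a b a' b' := by
  unfold varSpeed
  positivity

/-- The difference quotient of `varSpeed` in `s²`. -/
def varQuot (β s a b a' b' : ℝ) : ℝ :=
  (β * (a' + 2 * b) ^ 2 + (b' - 2 * a) ^ 2 - 2 * (a ^ 2 + b ^ 2 - (a * b' - b * a'))
    + s ^ 2 * (a ^ 2 + b ^ 2 - (a * b' - b * a')) ^ 2
    - 2 * (a ^ 2 + b ^ 2) - s ^ 2 * (a ^ 2 + b ^ 2) ^ 2) / (1 + s ^ 2 * (a ^ 2 + b ^ 2)) ^ 2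

theorem varSpeed_eq (β s a b a' b' : ℝ) :
    varSpeed β s a b a' b' = 1 + s ^ 2 * varQuot β s a b a' b' := by
  have : (1 + s ^ 2 * (a ^ 2 + b ^ 2)) ^ 2 ≠ 0 := by positivity
  unfold varSpeed varQuot
  field_simp
  ring

/-- Variation of the horizontal great circle `t ↦ (cos t, sin t)` of the Berger sphere by the
fields `a` (vertical) and `b` (horizontal). -/
theorem exists_variation (β s : ℝ) {a b a' b' : ℝ → ℝ} (ha : ContDiff ℝ 1 a)
    (hb : ContDiff ℝ 1 b) (ha' : ∀ t, HasDerivAt a (a' t) t) (hb' : ∀ t, HasDerivAt b (b' t) t) :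
    ∃ c c' : ℝ → Matrix (Fin 4) (Fin 2) ℝ, ContDiff ℝ 1 c ∧ (∀ t, c t ∈ stiefel 4 2) ∧
      (∀ t, HasDerivAt c (c' t) t) ∧
      (∀ t, a t = 0 → b t = 0 → c t = berger (Real.cos t) 0 (Real.sin t) 0) ∧
      ∀ t, metric β (c t) (c' t) (c' t) = 2 * varSpeed β s (a t) (b t) (a' t) (b' t) := by
  set N : ℝ → ℝ := fun t => 1 + s ^ 2 * (a t ^ 2 + b t ^ 2) with hNdef
  set ρ : ℝ → ℝ := fun t => (Real.sqrt (N t))⁻¹ with hρdef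
  set D : ℝ → ℝ := fun t => s ^ 2 * (a t * a' t + b t * b' t) with hDdef
  have hN : ∀ t, 0 < N t := fun t => by simp only [hNdef]; positivity
  have hρN : ∀ t, ρ t ^ 2 * N t = 1 := fun t => by
    simp only [hρdef]
    rw [inv_pow, Real.sq_sqrt (hN t).le, inv_mul_cancel₀ (hN t).ne']
  have hNd : ∀ t, HasDerivAt N (2 * D t) t := fun t => by
    have h := ((((ha' t).pow 2).add ((hb' t).pow 2)).const_mul (s ^ 2)).const_add 1
    refine h.congr_deriv ?_
    simp only [hDdef]
    push_cast
    ring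
  have hρd : ∀ t, HasDerivAt ρ (-(ρ t ^ 3 * D t)) t := fun t => by
    have h := ((hNd t).sqrt (hN t).ne').inv (Real.sqrt_pos.2 (hN t)).ne'
    refine h.congr_deriv ?_
    have h0 := (Real.sqrt_pos.2 (hN t)).ne'
    simp only [hρdef]
    field_simp
  have hρc : ContDiff ℝ 1 ρ := by
    have hNc : ContDiff ℝ 1 N := contDiff_const.add (contDiff_const.mul ((ha.pow 2).add (hb.pow 2)))
    exact (hNc.sqrt fun t => (hN t).ne').inv fun t => (Real.sqrt_pos.2 (hN t)).ne'
  have hcos : ContDiff ℝ 1 Real.cos := Real.contDiff_cos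
  have hsin : ContDiff ℝ 1 Real.sin := Real.contDiff_sin
  have hu₂ : ∀ t, HasDerivAt (fun t => s * (a t * Real.cos t + b t * Real.sin t))
      (s * ((a' t + b t) * Real.cos t + (b' t - a t) * Real.sin t)) t := fun t => by
    refine ((((ha' t).mul (Real.hasDerivAt_cos t)).add
      ((hb' t).mul (Real.hasDerivAt_sin t))).const_mul s).congr_deriv ?_
    ring
  have hv₂ : ∀ t, HasDerivAt (fun t => s * (a t * Real.sin t - b t * Real.cos t))
      (s * ((a' t + b t) * Real.sin t - (b' t - a t) * Real.cos t)) t := fun t => by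
    refine ((((ha' t).mul (Real.hasDerivAt_sin t)).sub
      ((hb' t).mul (Real.hasDerivAt_cos t))).const_mul s).congr_deriv ?_
    ring
  have hsq : ∀ t, Real.cos t ^ 2 + (s * (a t * Real.cos t + b t * Real.sin t)) ^ 2
      + Real.sin t ^ 2 + (s * (a t * Real.sin t - b t * Real.cos t)) ^ 2 = N t := fun t => by
    simp only [hNdef]
    linear_combination (1 + s ^ 2 * (a t ^ 2 + b t ^ 2)) * Real.cos_sq_add_sin_sq t
  refine ⟨fun t => berger (ρ t * Real.cos t) (ρ t * (s * (a t * Real.cos t + b t * Real.sin t)))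
      (ρ t * Real.sin t) (ρ t * (s * (a t * Real.sin t - b t * Real.cos t))),
    fun t => berger (-(ρ t ^ 3 * D t) * Real.cos t + ρ t * -Real.sin t)
      (-(ρ t ^ 3 * D t) * (s * (a t * Real.cos t + b t * Real.sin t))
        + ρ t * (s * ((a' t + b t) * Real.cos t + (b' t - a t) * Real.sin t)))
      (-(ρ t ^ 3 * D t) * Real.sin t + ρ t * Real.cos t)
      (-(ρ t ^ 3 * D t) * (s * (a t * Real.sin t - b t * Real.cos t))
        + ρ t * (s * ((a' t + b t) * Real.sin t - (b' t - a t) * Real.cos t))),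
    ?_, fun t => ?_, fun t => ?_, fun t h1 h2 => ?_, fun t => ?_⟩
  · exact contDiff_berger (hρc.mul hcos)
      (hρc.mul (contDiff_const.mul ((ha.mul hcos).add (hb.mul hsin)))) (hρc.mul hsin)
      (hρc.mul (contDiff_const.mul ((ha.mul hsin).sub (hb.mul hcos))))
  · refine berger_mem ?_
    linear_combination ρ t ^ 2 * hsq t + hρN t
  · exact hasDerivAt_berger ((hρd t).mul (Real.hasDerivAt_cos t)) ((hρd t).mul (hu₂ t))
      ((hρd t).mul (Real.hasDerivAt_sin t)) ((hρd t).mul (hv₂ t))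
  · simp [hρdef, hNdef, h1, h2]
  · have hCS := Real.cos_sq_add_sin_sq t
    rw [metric_berger_normalized β (ρ t) _ _ _ _ _ _ _ _ (N t)
      (1 + s ^ 2 * ((a' t + b t) ^ 2 + (b' t - a t) ^ 2)) (D t) (s * (a' t + 2 * b t)) (hsq t)
      ?_ ?_ ?_ (hρN t)]
    · rw [varSpeed]
      congr 2
      simp only [hNdef, hDdef]
      ring
    · linear_combination (1 + s ^ 2 * ((a' t + b t) ^ 2 + (b' t - a t) ^ 2)) * hCS
    · simp only [hDdef]
      linear_combination (s ^ 2 * (a t * a' t + b t * b' t)) * hCS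
    · linear_combination (s * (a' t + 2 * b t)) * hCS

theorem integral_sqrt_one_add_lt {T ε : ℝ} (hT : 0 ≤ T) (hε : 0 < ε) {q : ℝ → ℝ}
    (hq : Continuous q) (h0 : ∀ t, 0 ≤ 1 + ε * q t) (hI : ∫ t in (0 : ℝ)..T, q t < 0) :
    ∫ t in (0 : ℝ)..T, Real.sqrt (1 + ε * q t) < T := by
  calc ∫ t in (0 : ℝ)..T, Real.sqrt (1 + ε * q t)
      ≤ ∫ t in (0 : ℝ)..T, (1 + ε / 2 * q t) := by
        refine intervalIntegral.integral_mono_on hT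
          (Continuous.intervalIntegrable (by fun_prop) _ _)
          (Continuous.intervalIntegrable (by fun_prop) _ _) fun t _ => ?_
        refine Real.sqrt_le_iff.2 ⟨by linarith [h0 t], ?_⟩
        nlinarith [sq_nonneg (ε * q t)]
    _ = T + ε / 2 * ∫ t in (0 : ℝ)..T, q t := by
        rw [intervalIntegral.integral_add (by simp)
          (Continuous.intervalIntegrable (by fun_prop) _ _), intervalIntegral.integral_const_mul]
        simp
    _ < T := by
        have := mul_neg_of_pos_of_neg (by positivity : 0 < ε / 2) hI
        linarith

theorem continuous_varQuot (β : ℝ) {a b a' b' : ℝ → ℝ} (ha : Continuous a) (hb : Continuous b)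
    (ha' : Continuous a') (hb' : Continuous b') :
    Continuous (fun z : ℝ × ℝ => varQuot β z.1 (a z.2) (b z.2) (a' z.2) (b' z.2)) := by
  unfold varQuot
  refine Continuous.div (by fun_prop) (by fun_prop) fun z => ?_
  positivity

/-- If the second variation of the energy along the fields `a`, `b` is negative, then the
horizontal great circle is not minimizing on `[0, T]`. -/
theorem exists_shorter {β T : ℝ} (hβ : 0 < β) (hT : 0 ≤ T) {a b a' b' : ℝ → ℝ}
    (ha : ContDiff ℝ 1 a) (hb : ContDiff ℝ 1 b) (ha' : ∀ t, HasDerivAt a (a' t) t)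
    (hb' : ∀ t, HasDerivAt b (b' t) t) (hac' : Continuous a') (hbc' : Continuous b')
    (ha0 : a 0 = 0) (haT : a T = 0) (hb0 : b 0 = 0) (hbT : b T = 0)
    (hI : ∫ t in (0 : ℝ)..T, (β * (a' t + 2 * b t) ^ 2 + b' t ^ 2 - 4 * b t ^ 2
      - 2 * (a t * b' t + a' t * b t)) < 0) :
    ∃ c c' : ℝ → Matrix (Fin 4) (Fin 2) ℝ, ContDiff ℝ 1 c ∧ (∀ t, c t ∈ stiefel 4 2) ∧
      (∀ t, HasDerivAt c (c' t) t) ∧ c 0 = berger (Real.cos 0) 0 (Real.sin 0) 0 ∧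
      c T = berger (Real.cos T) 0 (Real.sin T) 0 ∧
      ∫ t in (0 : ℝ)..T, Real.sqrt (metric β (c t) (c' t) (c' t)) < Real.sqrt 2 * T := by
  have hac := ha.continuous
  have hbc := hb.continuous
  have hcont : Continuous (Function.uncurry fun s t : ℝ =>
      varQuot β s (a t) (b t) (a' t) (b' t)) := continuous_varQuot β hac hbc hac' hbc'
  have hJ := intervalIntegral.continuous_parametric_intervalIntegral_of_continuous (a₀ := 0)
    (μ := MeasureTheory.volume) hcont (continuous_const (y := T))
  have hJ0 : ∫ t in (0 : ℝ)..T, varQuot β 0 (a t) (b t) (a' t) (b' t) < 0 := by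
    refine lt_of_eq_of_lt (intervalIntegral.integral_congr fun t _ => ?_) hI
    simp only [varQuot]
    ring
  obtain ⟨s, hs, hsJ⟩ : ∃ s : ℝ, 0 < s ∧
      ∫ t in (0 : ℝ)..T, varQuot β s (a t) (b t) (a' t) (b' t) < 0 := by
    have h := (hJ.tendsto 0).eventually (gt_mem_nhds hJ0)
    have h' := (h.filter_mono nhdsWithin_le_nhds).and
      (self_mem_nhdsWithin : Set.Ioi (0 : ℝ) ∈ nhdsWithin 0 (Set.Ioi 0))
    obtain ⟨s, h1, h2⟩ := h'.exists
    exact ⟨s, h2, h1⟩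
  obtain ⟨c, c', hc, hmem, hd, hend, hmet⟩ := exists_variation β s ha hb ha' hb'
  refine ⟨c, c', hc, hmem, hd, hend 0 ha0 hb0, hend T haT hbT, ?_⟩
  have hqc : Continuous fun t => varQuot β s (a t) (b t) (a' t) (b' t) := by
    unfold varQuot
    exact Continuous.div (by fun_prop) (by fun_prop) fun t => by positivity
  have hspeed : ∀ t, Real.sqrt (metric β (c t) (c' t) (c' t)) = Real.sqrt 2
      * Real.sqrt (1 + s ^ 2 * varQuot β s (a t) (b t) (a' t) (b' t)) := fun t => by
    rw [hmet, varSpeed_eq, Real.sqrt_mul (by norm_num)]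
  simp only [hspeed, intervalIntegral.integral_const_mul]
  refine mul_lt_mul_of_pos_left (integral_sqrt_one_add_lt hT (pow_pos hs 2) hqc (fun t => ?_) hsJ)
    (by positivity)
  rw [← varSpeed_eq]
  exact varSpeed_nonneg hβ _ _ _ _ _

/-- Past the first conjugate point the horizontal great circle is not minimizing. -/
theorem exists_shorter_of_neg {β T : ℝ} (hβ : 0 < β) (hT : 0 < T)
    (hB : 0 < Real.sin T - T * Real.cos T)
    (hneg : Real.sin T / T + (1 - β) / β * Real.cos T < 0) :
    ∃ c c' : ℝ → Matrix (Fin 4) (Fin 2) ℝ, ContDiff ℝ 1 c ∧ (∀ t, c t ∈ stiefel 4 2) ∧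
      (∀ t, HasDerivAt c (c' t) t) ∧ c 0 = berger (Real.cos 0) 0 (Real.sin 0) 0 ∧
      c T = berger (Real.cos T) 0 (Real.sin T) 0 ∧
      ∫ t in (0 : ℝ)..T, Real.sqrt (metric β (c t) (c' t) (c' t)) < Real.sqrt 2 * T := by
  have hlin : ∀ t : ℝ, HasDerivAt (fun t => 2 * t - T) 2 t := fun t => by
    simpa using ((hasDerivAt_id t).const_mul 2).sub_const T
  have hsin := fun t => (hlin t).sin
  have hcos := fun t => (hlin t).cos
  have hline (r t : ℝ) : HasDerivAt (fun t => r * t) r t := by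
    simpa using (hasDerivAt_id t).const_mul r
  have ha' : ∀ t, HasDerivAt
      (fun t => 2 * (Real.sin T / T) * t - Real.sin (2 * t - T) - Real.sin T)
      (2 * (Real.sin T / T) - 2 * Real.cos (2 * t - T)) t := fun t => by
    refine (((hline _ t).sub (hsin t)).sub_const (Real.sin T)).congr_deriv ?_
    ring
  have hb' : ∀ t, HasDerivAt (fun t => Real.cos (2 * t - T) - Real.cos T)
      (-2 * Real.sin (2 * t - T)) t := fun t => by
    refine ((hcos t).sub_const (Real.cos T)).congr_deriv ?_
    ring
  refine exists_shorter hβ hT.le (by fun_prop) (by fun_prop) ha' hb' (by fun_prop)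
    (by fun_prop) (by simp) ?_ (by simp) ?_ ?_
  · rw [show 2 * T - T = T by ring]
    field_simp
    ring
  · rw [show 2 * T - T = T by ring, sub_self]
  have hΦ : ∀ t, HasDerivAt (fun t => β * (2 * (Real.sin T / T - Real.cos T)) ^ 2 * t
      + (Real.cos (2 * t - T) - Real.cos T) * (-2 * Real.sin (2 * t - T))
      + 4 * Real.cos T * ((1 / 2) * Real.sin (2 * t - T) - Real.cos T * t)
      - 2 * ((2 * (Real.sin T / T) * t - Real.sin (2 * t - T) - Real.sin T)
        * (Real.cos (2 * t - T) - Real.cos T)))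
      (β * (2 * (Real.sin T / T) - 2 * Real.cos (2 * t - T)
          + 2 * (Real.cos (2 * t - T) - Real.cos T)) ^ 2
        + (-2 * Real.sin (2 * t - T)) ^ 2 - 4 * (Real.cos (2 * t - T) - Real.cos T) ^ 2
        - 2 * ((2 * (Real.sin T / T) * t - Real.sin (2 * t - T) - Real.sin T)
            * (-2 * Real.sin (2 * t - T))
          + (2 * (Real.sin T / T) - 2 * Real.cos (2 * t - T))
            * (Real.cos (2 * t - T) - Real.cos T))) t := fun t => by
    have h := ((((hline (β * (2 * (Real.sin T / T - Real.cos T)) ^ 2) t).add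
      ((hb' t).mul ((hsin t).const_mul (-2)))).add
      ((((hsin t).const_mul (1 / 2)).sub (hline (Real.cos T) t)).const_mul
        (4 * Real.cos T))).sub (((ha' t).mul (hb' t)).const_mul 2))
    refine h.congr_deriv ?_
    ring
  rw [intervalIntegral.integral_eq_sub_of_hasDerivAt (fun t _ => hΦ t)
    (Continuous.intervalIntegrable (by fun_prop) _ _)]
  have hval : 4 * β * (Real.sin T - T * Real.cos T)
      * (Real.sin T / T + (1 - β) / β * Real.cos T) < 0 :=
    mul_neg_of_pos_of_neg (by positivity) hneg
  refine lt_of_eq_of_lt ?_ hval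
  rw [show 2 * T - T = T by ring, show 2 * 0 - T = -T by ring, Real.sin_neg, Real.cos_neg]
  field_simp
  ring

/-! ### The equation of the first conjugate point -/

theorem exists_isLeast_zero {f : ℝ → ℝ} {A B : ℝ} (hA : 0 < A) (hAB : A ≤ B)
    (hf : ContinuousOn f (Set.Icc A B)) (hlt : ∀ t, 0 < t → t < A → f t ≠ 0)
    (hfA : 0 ≤ f A) (hfB : f B ≤ 0) :
    ∃ r ∈ Set.Icc A B, IsLeast {t : ℝ | 0 < t ∧ f t = 0} r := by
  have hclosed : IsCompact (Set.Icc A B ∩ f ⁻¹' {0}) :=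
    isCompact_Icc.of_isClosed_subset (hf.preimage_isClosed_of_isClosed isClosed_Icc
      isClosed_singleton) Set.inter_subset_left
  have hne : (Set.Icc A B ∩ f ⁻¹' {0}).Nonempty := by
    obtain ⟨t, ht, h0⟩ := intermediate_value_Icc' hAB hf ⟨hfB, hfA⟩
    exact ⟨t, ht, h0⟩
  obtain ⟨r, ⟨hr, hr0⟩, hmin⟩ := hclosed.exists_isLeast hne
  refine ⟨r, hr, ⟨hA.trans_le hr.1, hr0⟩, fun t ht => ?_⟩
  rcases lt_or_ge t A with h | h
  · exact absurd ht.2 (hlt t ht.1 h)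
  rcases le_or_gt t B with h' | h'
  · exact hmin ⟨⟨h, h'⟩, ht.2⟩
  · exact hr.2.trans h'.le

theorem continuousOn_conjugate (β : ℝ) {A B : ℝ} (hA : 0 < A) :
    ContinuousOn (fun t : ℝ => Real.sin t / t + (1 - β) / β * Real.cos t) (Set.Icc A B) :=
  (Real.continuous_sin.continuousOn.div continuousOn_id
    fun _ ht => (hA.trans_le ht.1).ne').add (by fun_prop)

theorem exists_conjugate_of_le_one {β : ℝ} (hβ : 0 < β) (hβ1 : β ≤ 1) :
    ∃ r ∈ Set.Icc (Real.pi / 2) Real.pi,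
      IsLeast {t : ℝ | 0 < t ∧ Real.sin t / t + (1 - β) / β * Real.cos t = 0} r := by
  have hπ := Real.pi_pos
  have hκ : 0 ≤ (1 - β) / β := div_nonneg (by linarith) hβ.le
  refine exists_isLeast_zero (f := fun t => Real.sin t / t + (1 - β) / β * Real.cos t)
    (by positivity) (by linarith) (continuousOn_conjugate β (by positivity))
    (fun t h0 ht => ?_) ?_ ?_
  · have h1 := Real.sin_pos_of_pos_of_lt_pi h0 (by linarith)
    have h2 := Real.cos_pos_of_mem_Ioo ⟨by linarith, ht⟩
    have h3 := div_pos h1 h0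
    have h4 := mul_nonneg hκ h2.le
    exact (by linarith : (0 : ℝ) < _).ne'
  · simp only [Real.sin_pi_div_two, Real.cos_pi_div_two]
    positivity
  · simp only [Real.sin_pi, Real.cos_pi]
    linarith [zero_div Real.pi]

theorem exists_conjugate_of_one_lt {β : ℝ} (hβ1 : 1 < β) :
    ∃ r ∈ Set.Icc Real.pi (3 * Real.pi / 2),
      IsLeast {t : ℝ | 0 < t ∧ Real.sin t / t + (1 - β) / β * Real.cos t = 0} r := by
  have hπ := Real.pi_pos
  have hβ : 0 < β := by linarith
  have hκ : (1 - β) / β < 0 := div_neg_of_neg_of_pos (by linarith) hβ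
  have hκ' : -1 < (1 - β) / β := by rw [lt_div_iff₀ hβ]; linarith
  refine exists_isLeast_zero (f := fun t => Real.sin t / t + (1 - β) / β * Real.cos t)
    hπ (by linarith) (continuousOn_conjugate β hπ) (fun t h0 ht => ?_) ?_ ?_
  · have h1 := Real.sin_pos_of_pos_of_lt_pi h0 ht
    have h3 := div_pos h1 h0
    rcases lt_or_ge t (Real.pi / 2) with h | h
    · have h2 := Real.cos_pos_of_mem_Ioo ⟨by linarith, h⟩
      have h4 : Real.cos t < Real.sin t / t := by
        have h5 := Real.lt_tan h0 h
        rw [Real.tan_eq_sin_div_cos, lt_div_iff₀ h2] at h5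
        rw [lt_div_iff₀ h0]
        linarith
      have h6 : -Real.cos t < (1 - β) / β * Real.cos t := by nlinarith
      exact (by linarith : (0 : ℝ) < _).ne'
    · have h2 : Real.cos t ≤ 0 := Real.cos_nonpos_of_pi_div_two_le_of_le h (by linarith)
      have h4 := mul_nonneg_of_nonpos_of_nonpos hκ.le h2
      exact (by linarith : (0 : ℝ) < _).ne'
  · simp only [Real.sin_pi, Real.cos_pi]
    linarith [zero_div Real.pi]
  · have h1 : Real.sin (3 * Real.pi / 2) = -1 := by
      rw [show 3 * Real.pi / 2 = Real.pi / 2 + Real.pi by ring, Real.sin_add_pi,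
        Real.sin_pi_div_two]
    have h2 : Real.cos (3 * Real.pi / 2) = 0 := by
      rw [show 3 * Real.pi / 2 = Real.pi / 2 + Real.pi by ring, Real.cos_add_pi,
        Real.cos_pi_div_two, neg_zero]
    simp only [h1, h2, mul_zero, add_zero]
    exact div_nonpos_of_nonpos_of_nonneg (by norm_num) (by positivity)

theorem conjugate_neg_of_lt {β r T : ℝ} (hβ : 0 < β) (hβ1 : β < 1) (hr : Real.pi / 2 ≤ r)
    (hrT : r < T) (hT : T ≤ Real.pi)
    (h0 : Real.sin r / r + (1 - β) / β * Real.cos r = 0) :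
    Real.sin T / T + (1 - β) / β * Real.cos T < 0 := by
  have hπ := Real.pi_pos
  have hr0 : 0 < r := by linarith
  have hT0 : 0 < T := by linarith
  have hκ : 0 < (1 - β) / β := div_pos (by linarith) hβ
  generalize (1 - β) / β = κ at *
  have hcosr : Real.cos r ≤ 0 := Real.cos_nonpos_of_pi_div_two_le_of_le hr (by linarith)
  have hcos : Real.cos T < Real.cos r := Real.cos_lt_cos_of_nonneg_of_le_pi hr0.le hT hrT
  have hsin : Real.sin T < Real.sin r := by
    rw [← Real.cos_sub_pi_div_two, ← Real.cos_sub_pi_div_two]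
    exact Real.cos_lt_cos_of_nonneg_of_le_pi (by linarith) (by linarith) (by linarith)
  have hr' : Real.sin r + κ * (r * Real.cos r) = 0 := by
    field_simp at h0
    linarith
  have hmul : T * Real.cos T < r * Real.cos r := by nlinarith
  have hlt : Real.sin T + κ * (T * Real.cos T) < 0 := by nlinarith
  have : Real.sin T / T + κ * Real.cos T = (Real.sin T + κ * (T * Real.cos T)) / T := by
    field_simp
  rw [this]
  exact div_neg_of_neg_of_pos hlt hT0

/-! ### The three bounds -/

theorem injRadius_le_sqrt_mul_pi (F : Frame n p) {β : ℝ} (hβ : 0 < β) :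
    injRadius n p β ≤ ENNReal.ofReal (Real.sqrt (2 * β) * Real.pi) := by
  have hN : ∀ θ, circ (berger 1 0 0 0) (berger 0 1 0 0) 0 θ
      = berger (Real.cos θ) (Real.sin θ) 0 0 := fun θ => by
    ext i j
    fin_cases i <;> fin_cases j <;> simp [circ, berger]
  have hM : ∀ θ, circ (berger 0 1 0 0) (-berger 1 0 0 0) 0 θ
      = berger (-Real.sin θ) (Real.cos θ) 0 0 := fun θ => by
    ext i j
    fin_cases i <;> fin_cases j <;> simp [circ, berger]
  have hCS := Real.cos_sq_add_sin_sq
  refine injRadius_le_of_circ F (P := berger 1 0 0 0) (Q := berger 0 1 0 0) (Z := 0) (S := 1)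
    (A := !![0, -1; 1, 0]) (by positivity) (fun θ => ?_) (by simp) (fun θ => by simp) ?_
    (fun θ => ?_) (fun θ => ?_) (fun θ => ?_) (fun θ h1 h2 => absurd h1 h2.not_gt)
  · rw [hN]
    exact berger_mem (by linarith [hCS θ])
  · ext i j
    fin_cases i <;> fin_cases j <;> simp
  · rw [hN, hM]
    ext i j
    fin_cases i <;> fin_cases j <;>
      simp [berger, Matrix.mul_apply, Fin.sum_univ_four] <;> linarith [hCS θ]
  · rw [hN, hM]
    ext i j
    fin_cases i <;> fin_cases j <;> simp [berger, Matrix.mul_apply, Fin.sum_univ_two]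
  · rw [hN, hM, metric_berger]
    linear_combination (2 * β * (Real.cos θ ^ 2 + Real.sin θ ^ 2 + 1)
      - 2 * (Real.cos θ ^ 2 + Real.sin θ ^ 2)) * hCS θ

theorem injRadius_le_pi (F : Frame n p) (β : ℝ) :
    injRadius n p β ≤ ENNReal.ofReal Real.pi := by
  have hN : ∀ θ, circ !![1, 0; 0, 0; 0, 0; 0, 0] !![0, 0; 0, 0; 1, 0; 0, 0]
      !![0, 0; 0, 1; 0, 0; 0, 0] θ = !![Real.cos θ, 0; 0, 1; Real.sin θ, 0; 0, 0] := fun θ => by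
    ext i j
    fin_cases i <;> fin_cases j <;> simp [circ]
  have hM : ∀ θ, circ !![0, 0; 0, 0; 1, 0; 0, 0] (-!![1, 0; 0, 0; 0, 0; 0, 0]) 0 θ
      = !![-Real.sin θ, 0; 0, 0; Real.cos θ, 0; 0, 0] := fun θ => by
    ext i j
    fin_cases i <;> fin_cases j <;> simp [circ]
  have hK : ∀ θ, circ !![1, 0; 0, 0; 0, 0; 0, 0] !![0, 0; 0, 0; 1, 0; 0, 0] 0 θ
      = !![Real.cos θ, 0; 0, 0; Real.sin θ, 0; 0, 0] := fun θ => by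
    ext i j
    fin_cases i <;> fin_cases j <;> simp [circ]
  have hCS := Real.cos_sq_add_sin_sq
  have hA : ∀ θ : ℝ, (!![Real.cos θ, 0; 0, 1; Real.sin θ, 0; 0, 0]).transpose
      * !![-Real.sin θ, 0; 0, 0; Real.cos θ, 0; 0, 0] = 0 := fun θ => by
    ext i j
    fin_cases i <;> fin_cases j <;>
      simp [Matrix.mul_apply, Fin.sum_univ_four] <;> ring
  have h := injRadius_le_of_circ F (β := β) (v := 1) (T := Real.pi)
    (P := !![1, 0; 0, 0; 0, 0; 0, 0]) (Q := !![0, 0; 0, 0; 1, 0; 0, 0])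
    (Z := !![0, 0; 0, 1; 0, 0; 0, 0]) (S := !![1, 0; 0, 0])
    (A := 0) one_pos (fun θ => ?_) ?_ (fun θ => ?_) (by simp) (fun θ => ?_) (fun θ => by simp)
    (fun θ => ?_) (fun θ h1 h2 => absurd h1 h2.not_gt)
  · simpa using h
  · rw [hN]
    change Matrix.transpose _ * _ = (1 : Matrix (Fin 2) (Fin 2) ℝ)
    ext i j
    fin_cases i <;> fin_cases j <;>
      simp [Matrix.mul_apply, Fin.sum_univ_four] <;> linarith [hCS θ]
  · ext i j
    fin_cases i <;> fin_cases j <;> simp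
  · rw [hN, hK]
    ext i j
    fin_cases i <;> fin_cases j <;> simp [Matrix.mul_apply, Fin.sum_univ_two]
  · rw [hN, hM, hA]
  · rw [hN, hM, metric_self, hA]
    simp [Matrix.trace, Matrix.mul_apply, Fin.sum_univ_four, Fin.sum_univ_two]
    linarith [hCS θ]

theorem injRadius_le_conjugate (F : Frame n p) {β r : ℝ} (hβ : 0 < β) (hβ1 : β < 1)
    (hr : Real.pi / 2 ≤ r) (h0 : Real.sin r / r + (1 - β) / β * Real.cos r = 0) :
    injRadius n p β ≤ ENNReal.ofReal (Real.sqrt 2 * r) := by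
  have hN : ∀ θ, circ (berger 1 0 0 0) (berger 0 0 1 0) 0 θ
      = berger (Real.cos θ) 0 (Real.sin θ) 0 := fun θ => by
    ext i j
    fin_cases i <;> fin_cases j <;> simp [circ, berger]
  have hM : ∀ θ, circ (berger 0 0 1 0) (-berger 1 0 0 0) 0 θ
      = berger (-Real.sin θ) 0 (Real.cos θ) 0 := fun θ => by
    ext i j
    fin_cases i <;> fin_cases j <;> simp [circ, berger]
  have hCS := Real.cos_sq_add_sin_sq
  refine injRadius_le_of_circ F (P := berger 1 0 0 0) (Q := berger 0 0 1 0) (Z := 0) (S := 1)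
    (A := 0) two_pos (fun θ => ?_) (by simp) (fun θ => by simp) (by simp)
    (fun θ => ?_) (fun θ => by simp) (fun θ => ?_) (fun θ h1 h2 => ?_)
  · rw [hN]
    exact berger_mem (by linarith [hCS θ])
  · rw [hN, hM]
    ext i j
    fin_cases i <;> fin_cases j <;>
      simp [berger, Matrix.mul_apply, Fin.sum_univ_four] <;> ring
  · rw [hN, hM, metric_berger]
    linear_combination 2 * hCS θ
  · have hπ := Real.pi_pos
    have hθ : 0 < θ := by linarith
    have hcos : Real.cos θ < 0 :=
      Real.cos_neg_of_pi_div_two_lt_of_lt (by linarith) (by linarith)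
    have hsin : 0 ≤ Real.sin θ := Real.sin_nonneg_of_nonneg_of_le_pi hθ.le h2
    have hB : 0 < Real.sin θ - θ * Real.cos θ := by
      linarith [mul_neg_of_pos_of_neg hθ hcos]
    obtain ⟨c, c', hc, hmem, hd, hc0, hcθ, hlen⟩ :=
      exists_shorter_of_neg hβ hθ hB (conjugate_neg_of_lt hβ hβ1 hr h1 h2 h0)
    rw [hN, hN, ← hc0, ← hcθ]
    exact (F.stiefelDist_embed_le β hc hmem hd hθ.le).trans_lt
      ((ENNReal.ofReal_lt_ofReal_iff (by positivity)).2 hlen)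

end

end StiefelInj

theorem theorem7p1 (n p : ℕ) (hp : 2 ≤ p) (hpn : p + 2 ≤ n) (β : ℝ) (hβ : 0 < β) :
    ∃ tr : ℝ, IsLeast {t : ℝ | 0 < t ∧ Real.sin t / t + (1 - β) / β * Real.cos t = 0} tr ∧
      StiefelInj.injRadius n p β ≤
        ENNReal.ofReal (min (min (Real.sqrt (2 * β) * Real.pi) Real.pi) (tr * Real.sqrt 2)) := by
  obtain ⟨F⟩ := StiefelInj.nonempty_frame hp hpn
  have h1 := StiefelInj.injRadius_le_sqrt_mul_pi F hβ
  have h2 := StiefelInj.injRadius_le_pi F β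
  suffices h : ∃ tr : ℝ,
      IsLeast {t : ℝ | 0 < t ∧ Real.sin t / t + (1 - β) / β * Real.cos t = 0} tr ∧
        StiefelInj.injRadius n p β ≤ ENNReal.ofReal (tr * Real.sqrt 2) by
    obtain ⟨tr, htr, h3⟩ := h
    refine ⟨tr, htr, ?_⟩
    rcases min_choice (min (Real.sqrt (2 * β) * Real.pi) Real.pi) (tr * Real.sqrt 2) with h | h
    · rw [h]
      rcases min_choice (Real.sqrt (2 * β) * Real.pi) Real.pi with h' | h' <;> rw [h']
      exacts [h1, h2]
    · rw [h]
      exact h3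
  have hlarge : ∀ tr : ℝ, Real.pi ≤ tr →
      StiefelInj.injRadius n p β ≤ ENNReal.ofReal (tr * Real.sqrt 2) := fun tr htr => by
    refine h2.trans (ENNReal.ofReal_le_ofReal ?_)
    have hs : 1 ≤ Real.sqrt 2 := Real.one_le_sqrt.2 one_le_two
    nlinarith [Real.pi_pos]
  rcases le_or_gt β 1 with hβ1 | hβ1
  · obtain ⟨tr, hmem, hleast⟩ := StiefelInj.exists_conjugate_of_le_one hβ hβ1
    refine ⟨tr, hleast, ?_⟩
    rcases hβ1.lt_or_eq with hlt | rfl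
    · rw [mul_comm]
      exact StiefelInj.injRadius_le_conjugate F hβ hlt hmem.1 hleast.1.2
    · refine hlarge tr (le_of_not_gt fun hlt => ?_)
      have h0 := hleast.1.2
      have hsin := div_pos (Real.sin_pos_of_pos_of_lt_pi hleast.1.1 hlt) hleast.1.1
      simp only [sub_self, zero_div, zero_mul, add_zero] at h0
      exact hsin.ne' h0
  · obtain ⟨tr, hmem, hleast⟩ := StiefelInj.exists_conjugate_of_one_lt hβ1
    exact ⟨tr, hleast, hlarge tr hmem.1⟩
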